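/- Let $B$ be the graph obtained from the Petersen graph by deleting two adjacent vertices $x,y$; let $a_1,a_2$ be the vertices of $B$ that were adjacent to $x$, and $b_1,b_2$ those that were adjacent to $y$. Let $C=(v_1,v_2,v_3)$ be a cycle of length $3$ in the complete graph $K_4$, with indices taken modulo $3$. The graph $\mathrm{Blowup}(K_4,C)$ is obtained from $K_4$ as follows: delete the three edges $v_iv_{i+1}$ of $C$; for each $i\in\{1,2,3\}$ add two new vertices $u_i,w_i$ and a disjoint copy $B_i$ of $B$, with the copies of $a_1,a_2,b_1,b_2$ denoted $a_1^i,a_2^i,b_1^i,b_2^i$; and for each $i$ add the edges $v_iu_i$, $v_iw_i$, $u_ib_1^i$, $w_ib_2^i$, $a_1^iu_{i+1}$, $a_2^iw_{i+1}$. (It is a cubic graph on $34$ vertices.) A cycle double cover of a graph is a multiset of cycles such that every edge of the graph lies in exactly two of them, counted with multiplicity. A 2-factor is a spanning 2-regular subgraph; it is part of a cycle double cover if it is the union of some of the cycles of the cover (which are then its components). Then no 2-factor of $\mathrm{Blowup}(K_4,C)$ is part of a cycle double cover of $\mathrm{Blowup}(K_4,C)$. -/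

import Mathlib

namespace SimpleGraph

/-- The Petersen graph, drawn as usual: `(0, i)` are the vertices of the outer pentagon,
`(1, i)` those of the inner pentagram, and `(0, i)`, `(1, i)` are joined by a spoke. -/
def petersen : SimpleGraph (Fin 2 × ZMod 5) :=
  SimpleGraph.fromRel fun p q =>
    (p.1 = 0 ∧ q.1 = 0 ∧ q.2 = p.2 + 1) ∨
    (p.1 = 1 ∧ q.1 = 1 ∧ q.2 = p.2 + 2) ∨
    (p.1 = 0 ∧ q.1 = 1 ∧ p.2 = q.2)

/-- The vertices of the 4-pole `B`: those of the Petersen graph except for the two adjacent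
vertices `(0, 0)` and `(1, 0)`. -/
abbrev PoleVertex : Type := {p : Fin 2 × ZMod 5 // p ≠ (0, 0) ∧ p ≠ (1, 0)}

/-- The 4-pole `B` without its semiedges. -/
def pole : SimpleGraph PoleVertex := petersen.induce {p | p ≠ (0, 0) ∧ p ≠ (1, 0)}

/-- The end in `B` of its semiedge `a₁`; the ends of `a₁`, `a₂` are the neighbours of the removed
vertex `(0, 0)` other than `(1, 0)`. -/
def poleA₁ : PoleVertex := ⟨(0, 1), by decide⟩

/-- The end of the semiedge `a₂`. -/
def poleA₂ : PoleVertex := ⟨(0, 4), by decide⟩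

/-- The end in `B` of its semiedge `b₁`; the ends of `b₁`, `b₂` are the neighbours of the removed
vertex `(1, 0)` other than `(0, 0)`. -/
def poleB₁ : PoleVertex := ⟨(1, 2), by decide⟩

/-- The end of the semiedge `b₂`. -/
def poleB₂ : PoleVertex := ⟨(1, 3), by decide⟩

/-- The vertices of a blowup along the cycles of a permutation `σ`: the old vertices and, for
every vertex `i` that is moved by `σ`, two new vertices `u i`, `w i` and a copy of the 4-pole `B`. -/
inductive BlowupVertex {V : Type*} (σ : Equiv.Perm V) : Type _
  | old (v : V)
  | u (i : {v : V // σ v ≠ v})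
  | w (i : {v : V // σ v ≠ v})
  | copy (i : {v : V // σ v ≠ v}) (p : PoleVertex)

/-- The edges of the blowup, each listed in one direction (the edges inside `G` and inside the
copies of `B` in both). -/
def BlowupRel {V : Type*} (G : SimpleGraph V) (σ : Equiv.Perm V) :
    BlowupVertex σ → BlowupVertex σ → Prop
  | .old x, .old y => G.Adj x y ∧ σ x ≠ y ∧ σ y ≠ x
  | .old x, .u i => x = i
  | .old x, .w i => x = i
  | .copy i p, .copy j q => i = j ∧ pole.Adj p q
  | .u i, .copy j p => (i = j ∧ p = poleB₁) ∨ ((i : V) = σ j ∧ p = poleA₁)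
  | .w i, .copy j p => (i = j ∧ p = poleB₂) ∨ ((i : V) = σ j ∧ p = poleA₂)
  | _, _ => False

/-- `Blowup(G, D)`, where the 2-regular subgraph `D` of `G` is given by the permutation `σ` of the
vertices that sends each vertex of `D` to the next one on its cycle in `D`, for a chosen direction
of each cycle, and fixes all other vertices. So a cycle `(v₁, …, vₖ)` of `D` is a cycle of `σ`, and
`vᵢ₊₁ = σ vᵢ`. All edges `vᵢvᵢ₊₁` are removed, `vᵢ` is joined to new vertices `uᵢ` and `wᵢ`, and a
copy `Bᵢ` of `B` is put between `uᵢ`, `wᵢ` (by its semiedges `b₁`, `b₂`) and `uᵢ₊₁`, `wᵢ₊₁` (by its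
semiedges `a₁`, `a₂`). -/
def blowup {V : Type*} (G : SimpleGraph V) (σ : Equiv.Perm V) : SimpleGraph (BlowupVertex σ) :=
  SimpleGraph.fromRel (BlowupRel G σ)

/-- A subgraph that is a cycle, i.e. consists of the vertices and edges of a closed walk of
positive length without repeated vertices and edges. -/
def Subgraph.IsCycleSubgraph {V : Type*} {G : SimpleGraph V} (H : G.Subgraph) : Prop :=
  ∃ (v : V) (p : G.Walk v v), p.IsCycle ∧ p.toSubgraph = H

/-- A 2-factor: a spanning 2-regular subgraph. -/
def Subgraph.IsTwoFactor {V : Type*} {G : SimpleGraph V} (F : G.Subgraph) : Prop :=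
  F.IsSpanning ∧ ∀ v : V, (F.neighborSet v).ncard = 2

open Classical in
/-- A cycle double cover: a multiset of cycles such that every edge lies in exactly two of them,
counted with multiplicity. -/
def IsCycleDoubleCover {V : Type*} (G : SimpleGraph V) (𝒞 : Multiset G.Subgraph) : Prop :=
  (∀ H ∈ 𝒞, H.IsCycleSubgraph) ∧ ∀ e ∈ G.edgeSet, 𝒞.countP (fun H => e ∈ H.edgeSet) = 2

/-- The subgraph `F` is part of the multiset `𝒞` of cycles: it is the union of some of them. (For
a 2-factor `F` of a finite graph, these are the components of `F`.) -/
def Subgraph.IsPartOf {V : Type*} {G : SimpleGraph V} (F : G.Subgraph)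
    (𝒞 : Multiset G.Subgraph) : Prop :=
  ∃ 𝓕 ≤ 𝒞, 𝓕.sup = F

end SimpleGraph

/-!
A cycle double cover `𝒞` that contains the cycles `𝓕` of a 2-factor `F` is turned into local data:
every edge `e` is labelled by the set of the cycles of `𝒞 - 𝓕` that pass through `e`. Both cycles
through an edge outside `F` belong to `𝒞 - 𝓕`, an edge of `F` has only one left, and a cycle meets
no edge or exactly two edges at a vertex. Hence the labels of the three edges at a vertex of degree
three are `{p}`, `{q}`, `{p, q}` with `p ≠ q`, the first two belonging to `F`
(`cubicRule_remainingCycles`). The connectedness of the cycles plays no further role: it remains to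
show that the blowup has no labelling of this kind. Edges of `F` are called single below.

The 4-pole `B` enters through three facts.
* By parity, exactly one of the semiedges `a₁`, `a₂` is single if and only if exactly one of `b₁`,
  `b₂` is (`PoleLabelling.parity`).
* If all four semiedges are single, then `a₁` and `a₂` have the same label, and so do `b₁` and `b₂`
  (`PoleLabelling.eq_of_isSingle`).
* If `a₁` is single and `a₂` is not, then the label of `a₁` is not contained in that of `a₂`
  (`PoleLabelling.not_subset`).

The automorphisms of the Petersen graph that preserve the deleted edge spread the last two facts
over all semiedges. Now let `vᵢ` be a vertex of the cycle whose edge to the fourth vertex `z` of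
`K₄` is single. Comparing the labels at `vᵢ`, `uᵢ`, `wᵢ` shows that, of the two pairs of semiedges
that meet there (those of `Bᵢ₋₁` and of `Bᵢ`), one has exactly one single semiedge, and the other
consists of single semiedges with different labels; so the opposite pair of the latter pole has no
single semiedge (`junction`). Two of the three edges at `z` are single, so this applies at two
consecutive vertices of the cycle. The only compatible outcome leaves no single semiedge on either
side of the third vertex, although `u` has only one further edge there, and must be incident with
two single edges.
-/

namespace SimpleGraph

/-! ### Labels of the three edges at a vertex -/

section Rule

variable {α : Type*} {x y z : Set α}

/-- The condition on the labels of the three edges at a vertex: up to order they are `{p}`, `{q}`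
and `{p, q}` for different `p` and `q`. -/
def CubicRule (x y z : Set α) : Prop :=
  ∃ p q : α, p ≠ q ∧
    ((x = {p} ∧ y = {q} ∧ z = {p, q}) ∨ (x = {p} ∧ z = {q} ∧ y = {p, q}) ∨
      (y = {p} ∧ z = {q} ∧ x = {p, q}))

/-- The label is that of an edge of the 2-factor: it consists of one cycle. -/
def IsSingle (x : Set α) : Prop := ∃ p, x = {p}

theorem isSingle_singleton (p : α) : IsSingle ({p} : Set α) := ⟨p, rfl⟩

theorem not_isSingle_pair {p q : α} (h : p ≠ q) : ¬ IsSingle ({p, q} : Set α) := by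
  rintro ⟨r, hr⟩
  have h1 : p ∈ ({r} : Set α) := hr ▸ by simp
  have h2 : q ∈ ({r} : Set α) := hr ▸ by simp
  exact h (h1.trans h2.symm)

namespace CubicRule

theorem isSingle (h : CubicRule x y z) :
    (IsSingle x ∧ IsSingle y ∧ ¬ IsSingle z) ∨ (IsSingle x ∧ ¬ IsSingle y ∧ IsSingle z) ∨
      (¬ IsSingle x ∧ IsSingle y ∧ IsSingle z) := by
  obtain ⟨p, q, h, ⟨rfl, rfl, rfl⟩ | ⟨rfl, rfl, rfl⟩ | ⟨rfl, rfl, rfl⟩⟩ := h <;>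
    simp [not_isSingle_pair h, isSingle_singleton]

theorem rotate (h : CubicRule x y z) : CubicRule y z x := by
  obtain ⟨p, q, h, h' | h' | h'⟩ := h
  · exact ⟨q, p, h.symm, by grind [Set.pair_comm]⟩
  · exact ⟨q, p, h.symm, by grind [Set.pair_comm]⟩
  · exact ⟨p, q, h, by grind [Set.pair_comm]⟩

theorem swap (h : CubicRule x y z) : CubicRule y x z := by
  obtain ⟨p, q, h, h' | h' | h'⟩ := h
  · exact ⟨q, p, h.symm, by grind [Set.pair_comm]⟩
  · exact ⟨p, q, h, by grind [Set.pair_comm]⟩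
  · exact ⟨p, q, h, by grind [Set.pair_comm]⟩

theorem eq_pair {p q : α} (h : CubicRule {p} {q} z) : p ≠ q ∧ z = {p, q} := by
  obtain ⟨r, s, h, ⟨h1, h2, rfl⟩ | ⟨-, -, h2⟩ | ⟨-, -, h2⟩⟩ := h
  · rw [Set.singleton_eq_singleton_iff] at h1 h2
    exact ⟨h1 ▸ h2 ▸ h, by rw [h1, h2]⟩
  all_goals exact absurd ⟨_, h2.symm⟩ (not_isSingle_pair h)

end CubicRule

end Rule

/-! ### Labellings of the 4-pole -/

/-- A labelling of the edges and semiedges of the 4-pole `B` that satisfies the rule at its eight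
vertices. The label of the outer edge between `(0, i)` and `(0, j)` is `eᵢⱼ`, that of the inner edge
between `(1, i)` and `(1, j)` is `tᵢⱼ`, and that of the spoke between `(0, i)` and `(1, i)` is
`sᵢ`. -/
structure PoleLabelling (α : Type*) where
  (a₁ a₂ b₁ b₂ e₁₂ e₂₃ e₃₄ s₁ s₂ s₃ s₄ t₁₃ t₁₄ t₂₄ : Set α)
  outer₁ : CubicRule a₁ e₁₂ s₁
  outer₂ : CubicRule e₁₂ s₂ e₂₃
  outer₃ : CubicRule e₃₄ s₃ e₂₃
  outer₄ : CubicRule e₃₄ s₄ a₂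
  inner₁ : CubicRule t₁₃ t₁₄ s₁
  inner₂ : CubicRule s₂ b₁ t₂₄
  inner₃ : CubicRule s₃ t₁₃ b₂
  inner₄ : CubicRule s₄ t₁₄ t₂₄

namespace PoleLabelling

variable {α : Type*} (P : PoleLabelling α)

/-- The symmetry of the pole that exchanges the semiedges `a₁` and `a₂` and fixes `b₁` and `b₂`. -/
def swapA : PoleLabelling α where
  a₁ := P.a₂
  a₂ := P.a₁
  b₁ := P.b₁
  b₂ := P.b₂
  e₁₂ := P.s₄
  e₂₃ := P.t₁₄
  e₃₄ := P.s₁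
  s₁ := P.e₃₄
  s₂ := P.t₂₄
  s₃ := P.t₁₃
  s₄ := P.e₁₂
  t₁₃ := P.s₃
  t₁₄ := P.e₂₃
  t₂₄ := P.s₂
  outer₁ := P.outer₄.rotate.swap
  outer₂ := P.inner₄.swap.rotate
  outer₃ := P.inner₁.rotate.rotate
  outer₄ := P.outer₁.rotate.swap
  inner₁ := P.outer₃.rotate
  inner₂ := P.inner₂.rotate.swap
  inner₃ := P.inner₃.swap
  inner₄ := P.outer₂.swap.rotate

/-- The symmetry of the pole that exchanges the semiedges at the two deleted vertices. Applied
twice, it exchanges `a₁` with `a₂` and `b₁` with `b₂`. -/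
def reverse : PoleLabelling α where
  a₁ := P.b₁
  a₂ := P.b₂
  b₁ := P.a₂
  b₂ := P.a₁
  e₁₂ := P.t₂₄
  e₂₃ := P.t₁₄
  e₃₄ := P.t₁₃
  s₁ := P.s₂
  s₂ := P.s₄
  s₃ := P.s₁
  s₄ := P.s₃
  t₁₃ := P.e₁₂
  t₁₄ := P.e₂₃
  t₂₄ := P.e₃₄
  outer₁ := P.inner₂.rotate
  outer₂ := P.inner₄.rotate.rotate
  outer₃ := P.inner₁.swap.rotate
  outer₄ := P.inner₃.swap
  inner₁ := P.outer₂.rotate.rotate.swap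
  inner₂ := P.outer₄.rotate
  inner₃ := P.outer₁.rotate.swap
  inner₄ := P.outer₃.rotate

theorem parity : (IsSingle P.a₁ ↔ IsSingle P.a₂) ↔ (IsSingle P.b₁ ↔ IsSingle P.b₂) := by
  have k1 := P.outer₁.isSingle
  have k2 := P.outer₂.isSingle
  have k3 := P.outer₃.isSingle
  have k4 := P.outer₄.isSingle
  have k5 := P.inner₁.isSingle
  have k6 := P.inner₂.isSingle
  have k7 := P.inner₃.isSingle
  have k8 := P.inner₄.isSingle
  grind

theorem eq_of_isSingle (h1 : IsSingle P.a₁) (h2 : IsSingle P.a₂) (h3 : IsSingle P.b₁)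
    (h4 : IsSingle P.b₂) : P.a₁ = P.a₂ := by
  obtain ⟨a₁, a₂, b₁, b₂, e₁₂, e₂₃, e₃₄, s₁, s₂, s₃, s₄, t₁₃, t₁₄, t₂₄, r1, r2, r3, r4, r5, r6, r7,
    r8⟩ := P
  dsimp only at *
  have k1 := r1.isSingle
  have k2 := r2.isSingle
  have k3 := r3.isSingle
  have k4 := r4.isSingle
  have k5 := r5.isSingle
  have k6 := r6.isSingle
  have k7 := r7.isSingle
  have k8 := r8.isSingle
  by_cases hs : IsSingle e₁₂
  -- The 2-factor joins the ends of `a₁`, `a₂` along the outer path, those of `b₁`, `b₂` along the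
  -- inner one.
  · have : IsSingle e₂₃ ∧ IsSingle e₃₄ ∧ IsSingle t₁₃ ∧ IsSingle t₁₄ ∧ IsSingle t₂₄ := by grind
    clear k1 k2 k3 k4 k5 k6 k7 k8
    obtain ⟨⟨e₂₃, rfl⟩, ⟨e₃₄, rfl⟩, ⟨t₁₃, rfl⟩, ⟨t₁₄, rfl⟩, ⟨t₂₄, rfl⟩⟩ := this
    obtain ⟨a₁, rfl⟩ := h1
    obtain ⟨a₂, rfl⟩ := h2
    obtain ⟨b₁, rfl⟩ := h3
    obtain ⟨b₂, rfl⟩ := h4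
    obtain ⟨e₁₂, rfl⟩ := hs
    obtain ⟨n1, rfl⟩ := r1.eq_pair
    obtain ⟨n2, rfl⟩ := r2.rotate.rotate.eq_pair
    obtain ⟨n3, rfl⟩ := r3.rotate.rotate.eq_pair
    obtain ⟨n4, rfl⟩ := r4.rotate.rotate.eq_pair
    obtain ⟨n5, h5⟩ := r5.eq_pair
    obtain ⟨n6, h6⟩ := r6.rotate.eq_pair
    obtain ⟨n7, h7⟩ := r7.rotate.eq_pair
    obtain ⟨n8, h8⟩ := r8.rotate.eq_pair
    clear r1 r2 r3 r4 r5 r6 r7 r8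
    simp only [Set.pair_eq_pair_iff, Set.singleton_eq_singleton_iff] at *
    grind
  -- The 2-factor uses all four spokes, the outer edge `e₂₃` and the inner edge `t₁₄`.
  · have : IsSingle s₁ ∧ IsSingle e₂₃ ∧ IsSingle s₂ ∧ IsSingle s₃ ∧ IsSingle s₄ ∧ IsSingle t₁₄ := by
      grind
    clear k1 k2 k3 k4 k5 k6 k7 k8
    obtain ⟨⟨s₁, rfl⟩, ⟨e₂₃, rfl⟩, ⟨s₂, rfl⟩, ⟨s₃, rfl⟩, ⟨s₄, rfl⟩, ⟨t₁₄, rfl⟩⟩ := this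
    obtain ⟨a₁, rfl⟩ := h1
    obtain ⟨a₂, rfl⟩ := h2
    obtain ⟨b₁, rfl⟩ := h3
    obtain ⟨b₂, rfl⟩ := h4
    obtain ⟨n1, rfl⟩ := r1.rotate.rotate.eq_pair
    obtain ⟨n2, h2⟩ := r2.rotate.eq_pair
    obtain ⟨n3, rfl⟩ := r3.rotate.eq_pair
    obtain ⟨n4, h4⟩ := r4.rotate.eq_pair
    obtain ⟨n5, rfl⟩ := r5.rotate.eq_pair
    obtain ⟨n6, rfl⟩ := r6.eq_pair
    obtain ⟨n7, h7⟩ := r7.rotate.rotate.eq_pair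
    obtain ⟨n8, h8⟩ := r8.eq_pair
    clear r1 r2 r3 r4 r5 r6 r7 r8
    simp only [Set.pair_eq_pair_iff, Set.singleton_eq_singleton_iff] at *
    grind

/-- The special case of `PoleLabelling.not_subset` to which the symmetries of the pole reduce it. -/
theorem not_subset_of_isSingle_b₁ (h1 : IsSingle P.a₁) (h2 : ¬ IsSingle P.a₂) (h3 : IsSingle P.b₁) :
    ¬ P.a₁ ⊆ P.a₂ := by
  have h4 : ¬ IsSingle P.b₂ := by have := P.parity; tauto
  obtain ⟨a₁, a₂, b₁, b₂, e₁₂, e₂₃, e₃₄, s₁, s₂, s₃, s₄, t₁₃, t₁₄, t₂₄, r1, r2, r3, r4, r5, r6, r7,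
    r8⟩ := P
  dsimp only at *
  have k1 := r1.isSingle
  have k2 := r2.isSingle
  have k3 := r3.isSingle
  have k4 := r4.isSingle
  have k5 := r5.isSingle
  have k6 := r6.isSingle
  have k7 := r7.isSingle
  have k8 := r8.isSingle
  -- The semiedges determine the 2-factor: in the pole, it consists of the path between the ends of
  -- `a₁` and `b₁` with the edges `e₁₂`, `s₂`, and of a pentagon.
  have : IsSingle e₁₂ ∧ IsSingle e₃₄ ∧ IsSingle s₂ ∧ IsSingle s₃ ∧ IsSingle s₄ ∧ IsSingle t₁₃ ∧
    IsSingle t₁₄ := by grind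
  clear k1 k2 k3 k4 k5 k6 k7 k8
  obtain ⟨⟨e₁₂, rfl⟩, ⟨e₃₄, rfl⟩, ⟨s₂, rfl⟩, ⟨s₃, rfl⟩, ⟨s₄, rfl⟩, ⟨t₁₃, rfl⟩, ⟨t₁₄, rfl⟩⟩ := this
  obtain ⟨a₁, rfl⟩ := h1
  obtain ⟨b₁, rfl⟩ := h3
  obtain ⟨n1, rfl⟩ := r1.eq_pair
  obtain ⟨n2, rfl⟩ := r2.eq_pair
  obtain ⟨n3, h3⟩ := r3.eq_pair
  obtain ⟨n4, rfl⟩ := r4.eq_pair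
  obtain ⟨n5, h5⟩ := r5.eq_pair
  obtain ⟨n6, rfl⟩ := r6.eq_pair
  obtain ⟨n7, rfl⟩ := r7.eq_pair
  obtain ⟨n8, h8⟩ := r8.eq_pair
  clear r1 r2 r3 r4 r5 r6 r7 r8 h2 h4
  simp only [Set.pair_eq_pair_iff, Set.singleton_subset_iff, Set.mem_insert_iff,
    Set.mem_singleton_iff] at *
  grind

theorem not_subset (h1 : IsSingle P.a₁) (h2 : ¬ IsSingle P.a₂) : ¬ P.a₁ ⊆ P.a₂ := by
  by_cases h3 : IsSingle P.b₁
  · exact P.not_subset_of_isSingle_b₁ h1 h2 h3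
  · have h4 : IsSingle P.b₂ := by have := P.parity; tauto
    -- `reverse` twice followed by `swapA` exchanges just `b₁` and `b₂`.
    exact P.reverse.reverse.swapA.not_subset_of_isSingle_b₁ h1 h2 h4

end PoleLabelling

/-! ### Two poles meeting at a vertex -/

section Junction

variable {α : Type*} {g d e : Set α}

/-- The case of `junction_reversed` in which the edge labelled `d` is single and the single
semiedge at its end belongs to `Q`. -/
theorem junction_of_isSingle (P Q : PoleLabelling α) (hg : IsSingle g) (hd : IsSingle d)
    (hQ : IsSingle Q.a₁) (rv : CubicRule g d e) (ru : CubicRule d Q.a₁ P.a₁)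
    (rw : CubicRule e Q.a₂ P.a₂) :
    IsSingle Q.a₂ ∧ ¬ IsSingle P.a₁ ∧ IsSingle P.a₂ ∧ ¬ IsSingle Q.b₁ ∧ ¬ IsSingle Q.b₂ := by
  have kv := rv.isSingle
  have ku := ru.isSingle
  have kw := rw.isSingle
  have hQ₂ : IsSingle Q.a₂ := by tauto
  have hP₁ : ¬ IsSingle P.a₁ := by tauto
  have hP₂ : IsSingle P.a₂ := by tauto
  have hP : ¬ P.a₂ ⊆ P.a₁ := P.swapA.not_subset hP₂ hP₁
  -- The label `e` is the union of `g` and `d`, and also of `P.a₂` and `Q.a₂`. As `d ⊆ P.a₁`, `hP`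
  -- leaves only `P.a₂ = g` and `Q.a₂ = d`, whereas `Q.a₁ ≠ d`.
  have hne : Q.a₁ ≠ Q.a₂ := by
    obtain ⟨g, rfl⟩ := hg
    obtain ⟨d, rfl⟩ := hd
    obtain ⟨x, hx⟩ := hQ
    obtain ⟨y, hy⟩ := hQ₂
    obtain ⟨z, hz⟩ := hP₂
    rw [hx] at ru
    rw [hy, hz] at rw
    obtain ⟨n1, rfl⟩ := rv.eq_pair
    obtain ⟨n2, h2⟩ := ru.eq_pair
    obtain ⟨n3, h3⟩ := rw.rotate.eq_pair
    simp only [hx, hy, hz, h2, Set.pair_eq_pair_iff, Set.singleton_subset_iff, Set.mem_insert_iff,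
      Set.mem_singleton_iff, ne_eq, Set.singleton_eq_singleton_iff] at *
    grind
  have hpar := Q.parity
  have hQb : ¬ (IsSingle Q.b₁ ∧ IsSingle Q.b₂) := fun h =>
    hne (Q.eq_of_isSingle hQ hQ₂ h.1 h.2)
  tauto

/-- The symmetric form of `junction`, with the pole `Q` reversed. -/
theorem junction_reversed (P Q : PoleLabelling α) (hg : IsSingle g) (rv : CubicRule g d e)
    (ru : CubicRule d Q.a₁ P.a₁) (rw : CubicRule e Q.a₂ P.a₂) :
    (IsSingle Q.a₁ ∧ IsSingle Q.a₂ ∧ ¬ (IsSingle P.a₁ ↔ IsSingle P.a₂) ∧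
        ¬ IsSingle Q.b₁ ∧ ¬ IsSingle Q.b₂) ∨
      (IsSingle P.a₁ ∧ IsSingle P.a₂ ∧ ¬ (IsSingle Q.a₁ ↔ IsSingle Q.a₂) ∧
        ¬ IsSingle P.b₁ ∧ ¬ IsSingle P.b₂) := by
  have kv := rv.isSingle
  by_cases hd : IsSingle d
  · have ku := ru.isSingle
    by_cases hQ : IsSingle Q.a₁
    · have := junction_of_isSingle P Q hg hd hQ rv ru rw
      tauto
    · have := junction_of_isSingle Q P hg hd (by tauto) rv ru.swap.rotate
        rw.swap.rotate
      tauto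
  · have he : IsSingle e := by tauto
    have rv' := rv.swap.rotate
    have kw := rw.isSingle
    by_cases hQ : IsSingle Q.a₂
    · have := junction_of_isSingle P.swapA Q.swapA hg he hQ rv' rw ru
      simp only [PoleLabelling.swapA] at this
      tauto
    · have := junction_of_isSingle Q.swapA P.swapA hg he
        (by simp only [PoleLabelling.swapA]; tauto) rv' rw.swap.rotate
        ru.swap.rotate
      simp only [PoleLabelling.swapA] at this
      tauto

/-- Two consecutive poles `P` and `Q` meet at a vertex that has a single edge (labelled `g`) to the
outside; `d` and `e` are the labels of its other two edges. Then one of the two pairs of semiedges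
that meet there is single, the other one has one single semiedge, and the other pair of semiedges
of the pole with the single pair has none. -/
theorem junction (P Q : PoleLabelling α) (hg : IsSingle g) (rv : CubicRule g d e)
    (ru : CubicRule d Q.b₁ P.a₁) (rw : CubicRule e Q.b₂ P.a₂) :
    (IsSingle Q.b₁ ∧ IsSingle Q.b₂ ∧ ¬ (IsSingle P.a₁ ↔ IsSingle P.a₂) ∧
        ¬ IsSingle Q.a₁ ∧ ¬ IsSingle Q.a₂) ∨
      (IsSingle P.a₁ ∧ IsSingle P.a₂ ∧ ¬ (IsSingle Q.b₁ ↔ IsSingle Q.b₂) ∧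
        ¬ IsSingle P.b₁ ∧ ¬ IsSingle P.b₂) := by
  have := junction_reversed P Q.reverse hg rv ru rw
  simp only [PoleLabelling.reverse] at this
  tauto

end Junction

/-! ### From a cycle double cover to a labelling -/

section Cover

variable {V : Type*} {G : SimpleGraph V}

/-- The set of the cycles in the multiset `R` that pass through the edge `vw`. Multiplicities are
not recorded. -/
def remainingCycles (R : Multiset G.Subgraph) (v w : V) : Set G.Subgraph :=
  {H | H ∈ R ∧ H.Adj v w}

theorem remainingCycles_comm (R : Multiset G.Subgraph) (v w : V) :
    remainingCycles R v w = remainingCycles R w v := by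
  simp only [remainingCycles, Subgraph.adj_comm]

theorem Subgraph.multiset_sup_adj (S : Multiset G.Subgraph) (v w : V) :
    S.sup.Adj v w ↔ ∃ H ∈ S, H.Adj v w := by
  induction S using Multiset.induction_on with
  | empty => simp
  | cons H S ih => simp [ih]

theorem Subgraph.exactly_two_of_ncard_neighborSet {H : G.Subgraph} {v x y z : V}
    (hxy : x ≠ y) (hxz : x ≠ z) (hyz : y ≠ z) (hv : ∀ n, G.Adj v n ↔ n = x ∨ n = y ∨ n = z)
    (h : (H.neighborSet v).ncard = 2) :
    (H.Adj v x ∧ H.Adj v y ∧ ¬ H.Adj v z) ∨ (H.Adj v x ∧ ¬ H.Adj v y ∧ H.Adj v z) ∨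
      (¬ H.Adj v x ∧ H.Adj v y ∧ H.Adj v z) := by
  obtain ⟨p, q, hpq, hs⟩ := Set.ncard_eq_two.1 h
  have key : ∀ n, H.Adj v n ↔ n = p ∨ n = q := fun n => by
    rw [← Subgraph.mem_neighborSet, hs]; simp
  have hp := (hv p).1 ((key p).2 (.inl rfl)).adj_sub
  have hq := (hv q).1 ((key q).2 (.inr rfl)).adj_sub
  simp only [key]
  grind

theorem Subgraph.IsCycleSubgraph.ncard_neighborSet {H : G.Subgraph} (hH : H.IsCycleSubgraph)
    {v w : V} (h : H.Adj v w) : (H.neighborSet v).ncard = 2 := by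
  obtain ⟨a, p, hp, rfl⟩ := hH
  exact hp.ncard_neighborSet_toSubgraph_eq_two ((Walk.mem_verts_toSubgraph p).1 h.fst_mem)

/-- If `vx` and `vy` are the edges of the 2-factor at `v`, the cycles that remain pass through
`vx` once, through `vy` once and through `vz` twice. -/
theorem exists_remainingCycles_eq {F : G.Subgraph} {𝒞 𝓕 R : Multiset G.Subgraph}
    (hC : IsCycleDoubleCover G 𝒞) (hR : 𝒞 = 𝓕 + R) (hsup : 𝓕.sup = F) {v x y z : V}
    (hxy : x ≠ y) (hxz : x ≠ z) (hyz : y ≠ z) (hv : ∀ n, G.Adj v n ↔ n = x ∨ n = y ∨ n = z)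
    (hx : F.Adj v x) (hy : F.Adj v y) (hz : ¬ F.Adj v z) :
    ∃ p q, p ≠ q ∧ remainingCycles R v x = {p} ∧ remainingCycles R v y = {q} ∧
      remainingCycles R v z = {p, q} := by
  classical
  have count : ∀ n, G.Adj v n → 𝓕.countP (fun H => H.Adj v n) + R.countP (fun H => H.Adj v n) = 2 :=
    fun n hn => by
      rw [← Multiset.countP_add, ← hR]
      convert hC.2 s(v, n) hn using 2
      exact Subgraph.mem_edgeSet.symm
  have atMostOne : ∀ n, F.Adj v n → (R.filter fun H => H.Adj v n).card ≤ 1 := fun n hn => by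
    have h1 : 0 < 𝓕.countP (fun H => H.Adj v n) :=
      Multiset.countP_pos.2 ((Subgraph.multiset_sup_adj _ _ _).1 (hsup ▸ hn))
    have h2 := count n hn.adj_sub
    rw [← Multiset.countP_eq_card_filter]
    omega
  have unique : ∀ n, F.Adj v n → ∀ H ∈ R, H.Adj v n → remainingCycles R v n = {H} := by
    intro n hn H hH hHn
    obtain ⟨K, hK⟩ := Multiset.card_eq_one.1 <| le_antisymm (atMostOne n hn) <|
      Multiset.card_pos_iff_exists_mem.2 ⟨H, Multiset.mem_filter.2 ⟨hH, hHn⟩⟩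
    have key : ∀ L, L ∈ R ∧ L.Adj v n ↔ L = K := fun L => by
      simpa using congrArg (L ∈ ·) hK
    ext L
    simp only [remainingCycles, Set.mem_ofPred_eq, Set.mem_singleton_iff, key, (key H).1 ⟨hH, hHn⟩]
  have two : (R.filter fun H => H.Adj v z).card = 2 := by
    have h1 : 𝓕.countP (fun H => H.Adj v z) = 0 :=
      Multiset.countP_eq_zero.2 fun H hH hHz =>
        hz (hsup ▸ (Subgraph.multiset_sup_adj _ _ _).2 ⟨H, hH, hHz⟩)
    have h2 := count z ((hv z).2 (.inr (.inr rfl)))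
    rw [← Multiset.countP_eq_card_filter]
    omega
  obtain ⟨p, q, hpq⟩ := Multiset.card_eq_two.1 two
  have mem_iff : ∀ L, L ∈ R ∧ L.Adj v z ↔ L = p ∨ L = q := fun L => by
    simpa using congrArg (L ∈ ·) hpq
  have hZ : remainingCycles R v z = {p, q} := by
    ext L; simp [remainingCycles, mem_iff]
  -- A remaining cycle through `vz` leaves `v` along exactly one of `vx` and `vy`.
  have turn : ∀ L ∈ R, L.Adj v z → (L.Adj v x ∧ ¬ L.Adj v y) ∨ (¬ L.Adj v x ∧ L.Adj v y) := by
    intro L hL hLz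
    have hcyc := hC.1 L (hR ▸ Multiset.mem_add.2 (.inr hL))
    have := Subgraph.exactly_two_of_ncard_neighborSet hxy hxz hyz hv (hcyc.ncard_neighborSet hLz)
    tauto
  -- Otherwise `vn` would be covered twice by remaining cycles and once more by a cycle in `𝓕`.
  have notBoth : ∀ n, F.Adj v n → ¬ (p.Adj v n ∧ q.Adj v n) := by
    rintro n hn ⟨hp, hq⟩
    have h1 : ((R.filter fun H => H.Adj v z).filter fun H => H.Adj v n).card ≤ 1 :=
      (Multiset.card_le_card
        (Multiset.filter_le_filter _ (Multiset.filter_le _ _))).trans (atMostOne n hn)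
    simp [hpq, Multiset.filter_singleton, hp, hq] at h1
  obtain ⟨hpR, hpz⟩ := (mem_iff p).2 (.inl rfl)
  obtain ⟨hqR, hqz⟩ := (mem_iff q).2 (.inr rfl)
  have hx' := notBoth x hx
  have hy' := notBoth y hy
  rcases turn p hpR hpz with ⟨hp, -⟩ | ⟨-, hp⟩ <;> rcases turn q hqR hqz with ⟨hq, -⟩ | ⟨-, hq⟩
  · exact absurd ⟨hp, hq⟩ hx'
  · exact ⟨p, q, by rintro rfl; exact hx' ⟨hp, hp⟩ |>.elim, unique x hx p hpR hp,
      unique y hy q hqR hq, hZ⟩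
  · exact ⟨q, p, by rintro rfl; exact hx' ⟨hq, hq⟩ |>.elim, unique x hx q hqR hq,
      unique y hy p hpR hp, by rw [hZ, Set.pair_comm]⟩
  · exact absurd ⟨hp, hq⟩ hy'

theorem cubicRule_remainingCycles {F : G.Subgraph} {𝒞 𝓕 R : Multiset G.Subgraph}
    (hF : F.IsTwoFactor) (hC : IsCycleDoubleCover G 𝒞) (hR : 𝒞 = 𝓕 + R) (hsup : 𝓕.sup = F)
    {v x y z : V} (hxy : x ≠ y) (hxz : x ≠ z) (hyz : y ≠ z)
    (hv : ∀ n, G.Adj v n ↔ n = x ∨ n = y ∨ n = z) :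
    CubicRule (remainingCycles R v x) (remainingCycles R v y) (remainingCycles R v z) := by
  rcases Subgraph.exactly_two_of_ncard_neighborSet hxy hxz hyz hv (hF.2 v) with
    ⟨hx, hy, hz⟩ | ⟨hx, hy, hz⟩ | ⟨hx, hy, hz⟩
  · obtain ⟨p, q, h, h'⟩ := exists_remainingCycles_eq hC hR hsup hxy hxz hyz hv hx hy hz
    exact ⟨p, q, h, .inl h'⟩
  · obtain ⟨p, q, h, h'⟩ := exists_remainingCycles_eq hC hR hsup hxz hxy hyz.symm
      (fun n => (hv n).trans (by tauto)) hx hz hy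
    exact ⟨p, q, h, .inr (.inl h')⟩
  · obtain ⟨p, q, h, h'⟩ := exists_remainingCycles_eq hC hR hsup hyz hxy.symm hxz.symm
      (fun n => (hv n).trans (by tauto)) hy hz hx
    exact ⟨p, q, h, .inr (.inr h')⟩

end Cover

/-! ### Neighbours in the blowup -/

section Blowup

variable {V : Type*} {G : SimpleGraph V} {σ : Equiv.Perm V}

/-- The next vertex on the cycle. -/
def next (i : {v : V // σ v ≠ v}) : {v : V // σ v ≠ v} :=
  ⟨σ i, fun h => i.2 (σ.injective h)⟩

theorem blowup_adj_old_old (x y : V) : (G.blowup σ).Adj (.old x) (.old y) ↔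
    G.Adj x y ∧ σ x ≠ y ∧ σ y ≠ x := by
  simp only [blowup, fromRel_adj, BlowupRel, G.adj_comm y x]
  constructor
  · tauto
  · rintro ⟨h, h1, h2⟩
    exact ⟨fun e => h.ne (BlowupVertex.old.inj e), .inl ⟨h, h1, h2⟩⟩

theorem blowup_adj_u (i : {v : V // σ v ≠ v}) (n : BlowupVertex σ) :
    (G.blowup σ).Adj (.u (next i)) n ↔
      n = .old (next i : V) ∨ n = .copy (next i) poleB₁ ∨ n = .copy i poleA₁ := by
  have hinj : ∀ j : {v : V // σ v ≠ v}, (next i : V) = σ j ↔ j = i := fun j =>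
    ⟨fun h => Subtype.ext (σ.injective h).symm, fun h => h ▸ rfl⟩
  cases n <;> simp [blowup, BlowupRel, hinj, eq_comm]

theorem blowup_adj_w (i : {v : V // σ v ≠ v}) (n : BlowupVertex σ) :
    (G.blowup σ).Adj (.w (next i)) n ↔
      n = .old (next i : V) ∨ n = .copy (next i) poleB₂ ∨ n = .copy i poleA₂ := by
  have hinj : ∀ j : {v : V // σ v ≠ v}, (next i : V) = σ j ↔ j = i := fun j =>
    ⟨fun h => Subtype.ext (σ.injective h).symm, fun h => h ▸ rfl⟩
  cases n <;> simp [blowup, BlowupRel, hinj, eq_comm]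

theorem blowup_adj_copy (i : {v : V // σ v ≠ v}) (p : PoleVertex) (n : BlowupVertex σ) :
    (G.blowup σ).Adj (.copy i p) n ↔ (∃ q, pole.Adj p q ∧ n = .copy i q) ∨
      (p = poleA₁ ∧ n = .u (next i)) ∨ (p = poleA₂ ∧ n = .w (next i)) ∨
      (p = poleB₁ ∧ n = .u i) ∨ (p = poleB₂ ∧ n = .w i) := by
  have hnext : ∀ j : {v : V // σ v ≠ v}, (j : V) = σ i ↔ j = next i := fun j =>
    (Subtype.ext_iff (a2 := next i)).symm
  cases n with
  | copy j q =>
    simp only [blowup, fromRel_adj, BlowupRel, pole.adj_comm q p]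
    have : pole.Adj p q → p ≠ q := fun h => h.ne
    grind
  | old x => simp [blowup, BlowupRel]
  | u j => simp [blowup, BlowupRel, hnext]; tauto
  | w j => simp [blowup, BlowupRel, hnext]; tauto

end Blowup
/-! ### Labellings of the blowup -/

/-- A labelling of the edges of a graph that satisfies the rule at every vertex of degree three. The
label of the edge `vw` is `c v w`; the values of `c` at nonadjacent pairs are irrelevant. -/
structure IsCubicLabelling {V α : Type*} (G : SimpleGraph V) (c : V → V → Set α) : Prop where
  symm : ∀ v w, c v w = c w v
  rule : ∀ v x y z, x ≠ y → x ≠ z → y ≠ z → (∀ n, G.Adj v n ↔ n = x ∨ n = y ∨ n = z) →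
    CubicRule (c v x) (c v y) (c v z)

instance : DecidableRel petersen.Adj :=
  inferInstanceAs (DecidableRel (SimpleGraph.fromRel _).Adj)

instance : DecidableRel pole.Adj :=
  inferInstanceAs (DecidableRel (petersen.comap _).Adj)

namespace IsCubicLabelling

variable {V α : Type*} {G : SimpleGraph V} {σ : Equiv.Perm V}
  {c : BlowupVertex σ → BlowupVertex σ → Set α}

theorem rule_u (h : IsCubicLabelling (G.blowup σ) c) (i : {v : V // σ v ≠ v}) :
    CubicRule (c (.old (next i : V)) (.u (next i))) (c (.copy (next i) poleB₁) (.u (next i)))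
      (c (.copy i poleA₁) (.u (next i))) := by
  rw [h.symm _ (.u _), h.symm _ (.u _), h.symm _ (.u _)]
  refine h.rule _ _ _ _ (by simp) (by simp) ?_ (blowup_adj_u i)
  exact fun e => absurd (BlowupVertex.copy.inj e).2 (by decide)

theorem rule_w (h : IsCubicLabelling (G.blowup σ) c) (i : {v : V // σ v ≠ v}) :
    CubicRule (c (.old (next i : V)) (.w (next i))) (c (.copy (next i) poleB₂) (.w (next i)))
      (c (.copy i poleA₂) (.w (next i))) := by
  rw [h.symm _ (.w _), h.symm _ (.w _), h.symm _ (.w _)]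
  refine h.rule _ _ _ _ (by simp) (by simp) ?_ (blowup_adj_w i)
  exact fun e => absurd (BlowupVertex.copy.inj e).2 (by decide)

/-- The rule at a vertex of a pole that is not the end of a semiedge. -/
theorem rule_copy (h : IsCubicLabelling (G.blowup σ) c) (i : {v : V // σ v ≠ v})
    (p x y z : PoleVertex) (hxyz : x ≠ y ∧ x ≠ z ∧ y ≠ z)
    (hp : ∀ q, pole.Adj p q ↔ q = x ∨ q = y ∨ q = z)
    (hs : p ≠ poleA₁ ∧ p ≠ poleA₂ ∧ p ≠ poleB₁ ∧ p ≠ poleB₂) :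
    CubicRule (c (.copy i p) (.copy i x)) (c (.copy i p) (.copy i y))
      (c (.copy i p) (.copy i z)) := by
  refine h.rule _ _ _ _ (by simpa using hxyz.1) (by simpa using hxyz.2.1)
    (by simpa using hxyz.2.2) fun n => ?_
  simp [blowup_adj_copy, hp, hs]

/-- The rule at the end of a semiedge of a pole, attached to the vertex `m` outside the pole. -/
theorem rule_copy_semiedge (h : IsCubicLabelling (G.blowup σ) c) (i : {v : V // σ v ≠ v})
    (p x y : PoleVertex) (m : BlowupVertex σ) (hm : ∀ q, .copy i q ≠ m) (hxy : x ≠ y)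
    (hp : ∀ q, pole.Adj p q ↔ q = x ∨ q = y)
    (hs : ∀ n : BlowupVertex σ, ((p = poleA₁ ∧ n = .u (next i)) ∨ (p = poleA₂ ∧ n = .w (next i)) ∨
      (p = poleB₁ ∧ n = .u i) ∨ (p = poleB₂ ∧ n = .w i)) ↔ n = m) :
    CubicRule (c (.copy i p) (.copy i x)) (c (.copy i p) (.copy i y)) (c (.copy i p) m) := by
  refine h.rule _ _ _ _ (by simpa using hxy) (hm x) (hm y) fun n => ?_
  simp [blowup_adj_copy, hp, hs, or_assoc]

/-- The labelling of the `i`-th pole. -/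
def poleLabelling (h : IsCubicLabelling (G.blowup σ) c) (i : {v : V // σ v ≠ v}) :
    PoleLabelling α where
  a₁ := c (.copy i poleA₁) (.u (next i))
  a₂ := c (.copy i poleA₂) (.w (next i))
  b₁ := c (.copy i poleB₁) (.u i)
  b₂ := c (.copy i poleB₂) (.w i)
  e₁₂ := c (.copy i poleA₁) (.copy i ⟨(0, 2), by decide⟩)
  e₂₃ := c (.copy i ⟨(0, 2), by decide⟩) (.copy i ⟨(0, 3), by decide⟩)
  e₃₄ := c (.copy i poleA₂) (.copy i ⟨(0, 3), by decide⟩)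
  s₁ := c (.copy i poleA₁) (.copy i ⟨(1, 1), by decide⟩)
  s₂ := c (.copy i poleB₁) (.copy i ⟨(0, 2), by decide⟩)
  s₃ := c (.copy i poleB₂) (.copy i ⟨(0, 3), by decide⟩)
  s₄ := c (.copy i poleA₂) (.copy i ⟨(1, 4), by decide⟩)
  t₁₃ := c (.copy i poleB₂) (.copy i ⟨(1, 1), by decide⟩)
  t₁₄ := c (.copy i ⟨(1, 1), by decide⟩) (.copy i ⟨(1, 4), by decide⟩)
  t₂₄ := c (.copy i poleB₁) (.copy i ⟨(1, 4), by decide⟩)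
  outer₁ := by
    refine (h.rule_copy_semiedge i _ _ _ _ (by simp) (by decide) (by decide)
      fun n => ?_).rotate.rotate
    simp [show poleA₁ ≠ poleA₂ by decide, show poleA₁ ≠ poleB₁ by decide,
      show poleA₁ ≠ poleB₂ by decide]
  outer₂ := by
    have := h.rule_copy i ⟨(0, 2), by decide⟩ poleA₁ poleB₁ ⟨(0, 3), by decide⟩ (by decide)
      (by decide) (by decide)
    rwa [h.symm _ (.copy i poleA₁), h.symm _ (.copy i poleB₁)] at this
  outer₃ := by
    have := h.rule_copy i ⟨(0, 3), by decide⟩ poleA₂ poleB₂ ⟨(0, 2), by decide⟩ (by decide)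
      (by decide) (by decide)
    rwa [h.symm _ (.copy i poleA₂), h.symm _ (.copy i poleB₂),
      h.symm _ (.copy i ⟨(0, 2), _⟩)] at this
  outer₄ := by
    refine h.rule_copy_semiedge i _ _ _ _ (by simp) (by decide) (by decide) fun n => ?_
    simp [show poleA₂ ≠ poleA₁ by decide, show poleA₂ ≠ poleB₁ by decide,
      show poleA₂ ≠ poleB₂ by decide]
  inner₁ := by
    have := h.rule_copy i ⟨(1, 1), by decide⟩ poleB₂ ⟨(1, 4), by decide⟩ poleA₁ (by decide)
      (by decide) (by decide)
    rwa [h.symm _ (.copy i poleA₁), h.symm _ (.copy i poleB₂)] at this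
  inner₂ := by
    refine (h.rule_copy_semiedge i _ _ _ _ (by simp) (by decide) (by decide)
      fun n => ?_).swap.rotate
    simp [show poleB₁ ≠ poleA₁ by decide, show poleB₁ ≠ poleA₂ by decide,
      show poleB₁ ≠ poleB₂ by decide]
  inner₃ := by
    refine h.rule_copy_semiedge i _ _ _ _ (by simp) (by decide) (by decide) fun n => ?_
    simp [show poleB₂ ≠ poleA₁ by decide, show poleB₂ ≠ poleA₂ by decide,
      show poleB₂ ≠ poleB₁ by decide]
  inner₄ := by
    have := h.rule_copy i ⟨(1, 4), by decide⟩ poleA₂ ⟨(1, 1), by decide⟩ poleB₁ (by decide)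
      (by decide) (by decide)
    rwa [h.symm _ (.copy i poleA₂), h.symm _ (.copy i poleB₁), h.symm _ (.copy i ⟨(1, 1), _⟩)]
      at this

end IsCubicLabelling

/-! ### The blowup of the complete graph on four vertices -/

theorem exists_fixed_of_isThreeCycle : ∀ σ : Equiv.Perm (Fin 4), σ.IsThreeCycle →
    ∃ z, σ z = z ∧ ∀ x, x ≠ z →
      σ x ≠ x ∧ σ (σ x) ≠ x ∧ σ (σ (σ x)) = x ∧ ∀ y, y = z ∨ y = x ∨ y = σ x ∨ y = σ (σ x) := by
  intro σ hσ
  have h : σ ≠ 1 ∧ σ ^ 3 = 1 := ⟨hσ.isCycle.ne_one, hσ.orderOf ▸ pow_orderOf_eq_one σ⟩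
  clear hσ
  revert σ
  decide

section Final

variable {α : Type*} {σ : Equiv.Perm (Fin 4)}
  {c : BlowupVertex σ → BlowupVertex σ → Set α}

/-- If the edges from the fixed vertex to two consecutive vertices of the cycle are single, the two
junctions there force both pairs of semiedges that meet at the third vertex to be non-single. -/
theorem false_of_isSingle_isSingle
    (h : IsCubicLabelling ((⊤ : SimpleGraph (Fin 4)).blowup σ) c) {z : Fin 4}
    (hadj : ∀ i : {v // σ v ≠ v}, ∀ n, ((⊤ : SimpleGraph (Fin 4)).blowup σ).Adj (.old i) n ↔
      n = .old z ∨ n = .u i ∨ n = .w i)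
    (i : {v // σ v ≠ v}) (hi : next (next (next i)) = i)
    (h1 : IsSingle (c (.old i) (.old z))) (h2 : IsSingle (c (.old (next i)) (.old z))) : False := by
  have hv : ∀ j : {v // σ v ≠ v}, CubicRule (c (.old j) (.old z)) (c (.old j) (.u j))
      (c (.old j) (.w j)) := fun j =>
    h.rule _ _ _ _ (by simp) (by simp) (by simp) (hadj j)
  obtain ⟨k, hk⟩ : ∃ k, k = next (next i) := ⟨_, rfl⟩
  have hki : next k = i := hk ▸ hi
  have u1 := h.rule_u k
  have w1 := h.rule_w k
  rw [hki] at u1 w1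
  have j1 := junction (h.poleLabelling k) (h.poleLabelling i) h1 (hv i)
    (by simp only [IsCubicLabelling.poleLabelling, hki]; exact u1)
    (by simp only [IsCubicLabelling.poleLabelling, hki]; exact w1)
  have j2 := junction (h.poleLabelling i) (h.poleLabelling (next i)) h2 (hv (next i)) (h.rule_u i)
    (h.rule_w i)
  have u3 := (h.rule_u (next i)).isSingle
  rw [← hk] at u3
  have e1 : (h.poleLabelling (next i)).a₁ = c (.copy (next i) poleA₁) (.u k) := hk ▸ rfl
  have e2 : (h.poleLabelling k).b₁ = c (.copy k poleB₁) (.u k) := rfl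
  rw [← e1, ← e2] at u3
  tauto

theorem not_isCubicLabelling_blowup (hσ : σ.IsThreeCycle)
    (c : BlowupVertex σ → BlowupVertex σ → Set α) :
    ¬ IsCubicLabelling ((⊤ : SimpleGraph (Fin 4)).blowup σ) c := by
  intro h
  obtain ⟨z, hz, hz'⟩ := exists_fixed_of_isThreeCycle σ hσ
  have hne : ∀ i : {v // σ v ≠ v}, (i : Fin 4) ≠ z := by
    rintro ⟨i, hi⟩ rfl
    exact hi hz
  have hthree : ∀ i : {v // σ v ≠ v}, next (next (next i)) = i := fun i =>
    Subtype.ext (hz' i (hne i)).2.2.1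
  have hadj : ∀ i : {v // σ v ≠ v}, ∀ n,
      ((⊤ : SimpleGraph (Fin 4)).blowup σ).Adj (.old i) n ↔
        n = .old z ∨ n = .u i ∨ n = .w i := by
    intro i n
    cases n with
    | old y =>
      obtain ⟨h1, h2, h3, h4⟩ := hz' i (hne i)
      simp only [blowup_adj_old_old, top_adj, BlowupVertex.old.injEq, reduceCtorEq, or_false]
      constructor
      · rintro ⟨h5, h6, h7⟩
        rcases h4 y with h | h | h | h
        · exact h
        · exact absurd h.symm h5
        · exact absurd h.symm h6
        · exact absurd (by rw [h, h3]) h7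
      · rintro rfl
        refine ⟨hne i, fun h => ?_, fun h => hne i (h.symm.trans hz)⟩
        exact hne i (σ.injective (h.trans hz.symm))
    | u j => simp [blowup, BlowupRel, Subtype.ext_iff, eq_comm]
    | w j => simp [blowup, BlowupRel, Subtype.ext_iff, eq_comm]
    | copy j p => simp [blowup, BlowupRel]
  obtain ⟨x, hx⟩ : ∃ x, x ≠ z := exists_ne z
  obtain ⟨h1, h2, h3, h4⟩ := hz' x hx
  let i : {v // σ v ≠ v} := ⟨x, h1⟩
  have hzadj : ∀ n, ((⊤ : SimpleGraph (Fin 4)).blowup σ).Adj (.old z) n ↔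
      n = .old (i : Fin 4) ∨ n = .old (next i : Fin 4) ∨ n = .old (next (next i) : Fin 4) := by
    intro n
    cases n with
    | old y =>
      simp only [blowup_adj_old_old, top_adj, BlowupVertex.old.injEq, hz]
      have hy : (z ≠ y ∧ z ≠ y ∧ σ y ≠ z) ↔ y ≠ z :=
        ⟨fun h => h.1.symm, fun h => ⟨h.symm, h.symm, fun e => h (σ.injective (e.trans hz.symm))⟩⟩
      rw [hy]
      constructor
      · exact fun h => (h4 y).resolve_left h
      · rintro (rfl | rfl | rfl)
        exacts [hne i, hne (next i), hne (next (next i))]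
    | u j => simp [blowup, BlowupRel, (hne j).symm]
    | w j => simp [blowup, BlowupRel, (hne j).symm]
    | copy j p => simp [blowup, BlowupRel]
  have hrule := (h.rule (.old z) (.old (i : Fin 4)) (.old (next i : Fin 4))
    (.old (next (next i) : Fin 4))
    (fun e => h1 (BlowupVertex.old.inj e).symm) (fun e => h2 (BlowupVertex.old.inj e).symm)
    (fun e => h1 (σ.injective (BlowupVertex.old.inj e).symm)) hzadj).isSingle
  simp only [h.symm (.old z)] at hrule
  rcases hrule with ⟨k1, k2, -⟩ | ⟨k1, -, k3⟩ | ⟨-, k2, k3⟩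
  · exact false_of_isSingle_isSingle h hadj i (hthree _) k1 k2
  · exact false_of_isSingle_isSingle h hadj (next (next i)) (hthree _) k3 ((hthree i).symm ▸ k1)
  · exact false_of_isSingle_isSingle h hadj (next i) (hthree _) k2 k3

end Final

end SimpleGraph

theorem mainTheorem6 (σ : Equiv.Perm (Fin 4)) (hσ : σ.IsThreeCycle) :
    ¬ ∃ (F : ((⊤ : SimpleGraph (Fin 4)).blowup σ).Subgraph)
        (𝒞 : Multiset ((⊤ : SimpleGraph (Fin 4)).blowup σ).Subgraph),
      F.IsTwoFactor ∧ SimpleGraph.IsCycleDoubleCover _ 𝒞 ∧ F.IsPartOf 𝒞 := by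
  rintro ⟨F, 𝒞, hF, hC, 𝓕, hle, hsup⟩
  obtain ⟨R, hR⟩ := Multiset.le_iff_exists_add.1 hle
  exact SimpleGraph.not_isCubicLabelling_blowup hσ (SimpleGraph.remainingCycles R)
    ⟨SimpleGraph.remainingCycles_comm R, fun _ _ _ _ hxy hxz hyz hv =>
      SimpleGraph.cubicRule_remainingCycles hF hC hR hsup hxy hxz hyz hv⟩
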